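/- Let $H$ be a separable real Hilbert space, let $A\colon \mathcal{D}(A)\subset H\to H$ be a densely defined, self-adjoint, positive definite linear operator (not necessarily bounded) with a compact inverse, and let $0<T<\infty$, $\mathbb{T}=[0,T]$. Let $V=\mathcal{D}(A^{1/2})$ with the inner product $\langle\varphi,\psi\rangle_V=\langle A^{1/2}\varphi,A^{1/2}\psi\rangle_H$, and let $V\hookrightarrow H\cong H^*\hookrightarrow V^*$ be the associated Gelfand triple, where $V^*$ carries the dual norm. Let $A^*\in\mathcal{L}(V;V^*)$ be the operator with $\langle\psi,A^*\varphi\rangle=\langle\psi,\varphi\rangle_V$ for $\varphi,\psi\in V$. Define $$\mathcal{X}=L^2(\mathbb{T};V),\qquad \mathcal{Y}=\{v\in L^2(\mathbb{T};V)\cap H^1(\mathbb{T};V^*) : v(T)=0\},\qquad \|v\|_{\mathcal{Y}}^2=\|v\|_{L^2(\mathbb{T};V)}^2+\|\partial_t v\|_{L^2(\mathbb{T};V^*)}^2,$$ and let $\mathbb{B}\in\mathcal{L}(\mathcal{X};\mathcal{Y}')$ be the operator $$(\mathbb{B}u)(v)=\int_0^T\langle u(t),(-\partial_t+A^*)v(t)\rangle\,\mathrm{d}t,\qquad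 u\in\mathcal{X},\ v\in\mathcal{Y}.$$ For a Banach space $E$ let $E^{(\pi)}=E\,\hat{\otimes}_\pi E$ be its projective tensor square, i.e. the completion of $E\otimes E$ with respect to the norm $\|x\|=\inf\{\sum_{k=1}^N\|\varphi_k\|\,\|\psi_k\| : x=\sum_{k=1}^N\varphi_k\otimes\psi_k\}$. Then there is a unique operator $\mathbb{B}^{(\pi)}\in\mathcal{L}(\mathcal{X}^{(\pi)};(\mathcal{Y}')^{(\pi)})$ with $\mathbb{B}^{(\pi)}(u^1\otimes u^2)=\mathbb{B}u^1\otimes\mathbb{B}u^2$ for all $u^1,u^2\in\mathcal{X}$. This operator is injective and satisfies $$\|\mathbb{B}^{(\pi)}u\|_{(\mathcal{Y}')^{(\pi)}}\ \ge\ \|u\|_{\mathcal{X}^{(\pi)}}\qquad\text{for all } u\in\mathcal{X}^{(\pi)}.$$ -/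

import Mathlib

open MeasureTheory Set Filter Topology
open scoped ENNReal ContDiff TensorProduct InnerProductSpace

noncomputable section

namespace Parabolic

section Operator

/-- A densely defined, self-adjoint, positive definite (possibly unbounded) linear operator
`op : 𝒟(op) ⊆ H → H` with a compact inverse on a real Hilbert space `H`. -/
structure EllipticOperator (H : Type*) [NormedAddCommGroup H] [InnerProductSpace ℝ H]
    [CompleteSpace H] where
  /-- the operator, with its domain -/
  op : H →ₗ.[ℝ] H
  dense_domain : Dense (op.domain : Set H)
  isSelfAdjoint : IsSelfAdjoint op
  pos_def : ∀ x : op.domain, x ≠ 0 → 0 < ⟪op x, (x : H)⟫_ℝ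
  compact_inverse : ∃ K : H →L[ℝ] H, IsCompactOperator K ∧
    (∀ y : H, ∃ h : K y ∈ op.domain, op ⟨K y, h⟩ = y) ∧ ∀ x : op.domain, K (op x) = x

variable {H : Type*} [NormedAddCommGroup H] [InnerProductSpace ℝ H] [CompleteSpace H]

namespace EllipticOperator

variable (A : EllipticOperator H)

/-- The eigenspace `{x ∈ 𝒟(A) : A x = μ x}`. -/
def eigenspace (μ : ℝ) : Submodule ℝ H where
  carrier := {x | ∃ h : x ∈ A.op.domain, A.op ⟨x, h⟩ = μ • x}
  zero_mem' := ⟨A.op.domain.zero_mem, by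
    rw [smul_zero]; exact A.op.map_zero⟩
  add_mem' := by
    rintro x y ⟨hx, ex⟩ ⟨hy, ey⟩
    refine ⟨A.op.domain.add_mem hx hy, ?_⟩
    rw [smul_add, ← ex, ← ey, ← A.op.map_add]; rfl
  smul_mem' := by
    rintro c x ⟨hx, ex⟩
    refine ⟨A.op.domain.smul_mem c hx, ?_⟩
    rw [smul_comm, ← ex, ← A.op.map_smul]; rfl

/-- The inverse of `A`. -/
def inv : H →L[ℝ] H := A.compact_inverse.choose

theorem inv_compact : IsCompactOperator A.inv := A.compact_inverse.choose_spec.1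

theorem op_inv (y : H) : ∃ h : A.inv y ∈ A.op.domain, A.op ⟨A.inv y, h⟩ = y :=
  A.compact_inverse.choose_spec.2.1 y

theorem inv_op (x : A.op.domain) : A.inv (A.op x) = x := A.compact_inverse.choose_spec.2.2 x

theorem op_symm (x y : A.op.domain) : ⟪A.op x, (y : H)⟫_ℝ = ⟪(x : H), A.op y⟫_ℝ := by
  have h := LinearPMap.adjoint_isFormalAdjoint (T := A.op) A.dense_domain
  have e : A.op.adjoint = A.op := A.isSelfAdjoint
  rw [e] at h
  exact h x y

theorem inv_symm : (A.inv : H →ₗ[ℝ] H).IsSymmetric := by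
  intro x y
  obtain ⟨hx, ex⟩ := A.op_inv x
  obtain ⟨hy, ey⟩ := A.op_inv y
  have := A.op_symm ⟨A.inv x, hx⟩ ⟨A.inv y, hy⟩
  rw [ex, ey] at this
  exact this.symm

theorem mem_eigenspace_iff (μ : ℝ) (x : H) : x ∈ A.eigenspace μ ↔ μ • A.inv x = x := by
  constructor
  · rintro ⟨hx, ex⟩
    have := A.inv_op ⟨x, hx⟩
    rw [ex, map_smul] at this
    exact this
  · intro h
    obtain ⟨hx, ex⟩ := A.op_inv x
    have hx' : x ∈ A.op.domain := by
      rw [← h]; exact A.op.domain.smul_mem _ hx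
    refine ⟨hx', ?_⟩
    have : (⟨x, hx'⟩ : A.op.domain) = μ • ⟨A.inv x, hx⟩ := Subtype.ext h.symm
    rw [this, A.op.map_smul, ex]

theorem isClosed_eigenspace (μ : ℝ) : IsClosed (A.eigenspace μ : Set H) := by
  have : (A.eigenspace μ : Set H) = {x | μ • A.inv x = x} := by
    ext x; exact A.mem_eigenspace_iff μ x
  rw [this]
  exact isClosed_eq (by fun_prop) continuous_id

instance (μ : ℝ) : CompleteSpace (A.eigenspace μ) :=
  (A.isClosed_eigenspace μ).completeSpace_coe

/-- The orthogonal projection of `H` onto the eigenspace of `A` for `μ`. -/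
def proj (μ : ℝ) : H →L[ℝ] H := (A.eigenspace μ).starProjection

theorem proj_mem (μ : ℝ) (x : H) : A.proj μ x ∈ A.eigenspace μ :=
  Submodule.starProjection_apply_mem _ x

theorem eigenvalue_pos {μ : ℝ} {x : H} (hx : x ∈ A.eigenspace μ) (h0 : x ≠ 0) : 0 < μ := by
  obtain ⟨h, e⟩ := hx
  have := A.pos_def ⟨x, h⟩ (fun h' => h0 (congrArg Subtype.val h'))
  rw [e, real_inner_smul_left] at this
  exact pos_of_mul_pos_left this real_inner_self_nonneg

theorem orthogonalFamily_eigenspace :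
    OrthogonalFamily ℝ (fun μ => A.eigenspace μ) fun μ => (A.eigenspace μ).subtypeₗᵢ := by
  rintro μ ν hne ⟨x, hx, ex⟩ ⟨y, hy, ey⟩
  have := A.op_symm ⟨x, hx⟩ ⟨y, hy⟩
  rw [ex, ey, real_inner_smul_left, real_inner_smul_right] at this
  have h' : (μ - ν) * ⟪x, y⟫_ℝ = 0 := by
    rw [sub_mul]; exact sub_eq_zero.2 this
  exact (mul_eq_zero.1 h').resolve_left (sub_ne_zero.2 hne)

theorem isHilbertSum_eigenspace :
    IsHilbertSum ℝ (fun μ => A.eigenspace μ) fun μ => (A.eigenspace μ).subtypeₗᵢ := by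
  refine IsHilbertSum.mkInternal _ A.orthogonalFamily_eigenspace ?_
  rw [top_le_iff, Submodule.topologicalClosure_eq_top_iff, eq_bot_iff,
    ← ContinuousLinearMap.orthogonalComplement_iSup_eigenspaces_eq_bot A.inv_compact A.inv_symm]
  refine Submodule.orthogonal_le (iSup_le fun ν x hx => ?_)
  rw [Module.End.mem_eigenspace_iff] at hx
  have hx' : A.inv x = ν • x := hx
  by_cases hν : ν = 0
  · obtain ⟨h, e⟩ := A.op_inv x
    have hz : (⟨A.inv x, h⟩ : A.op.domain) = 0 := Subtype.ext (by simp [hx', hν])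
    rw [hz, A.op.map_zero] at e
    rw [← e]; exact Submodule.zero_mem _
  · refine Submodule.mem_iSup_of_mem (p := fun μ => A.eigenspace μ) ν⁻¹ ?_
    rw [mem_eigenspace_iff, hx', smul_smul, inv_mul_cancel₀ hν, one_smul]

theorem proj_of_hasSum {w : ℝ → H} (hw : ∀ μ, w μ ∈ A.eigenspace μ) {y : H} (h : HasSum w y)
    (μ : ℝ) : A.proj μ y = w μ := by
  have h1 := h.mapL (A.proj μ)
  refine h1.unique ?_
  have : ∀ ν, ν ≠ μ → A.proj μ (w ν) = 0 := by
    intro ν hν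
    refine (Submodule.starProjection_apply_eq_zero_iff _).2 ?_
    intro z hz
    exact A.orthogonalFamily_eigenspace (i := μ) (j := ν) hν.symm ⟨z, hz⟩ ⟨w ν, hw ν⟩
  have h2 := hasSum_single μ this
  rwa [show A.proj μ (w μ) = w μ from Submodule.starProjection_eq_self_iff.2 (hw μ)] at h2

theorem hasSum_proj (x : H) : HasSum (fun μ => A.proj μ x) x := by
  obtain ⟨w, rfl⟩ := A.isHilbertSum_eigenspace.surjective_isometry x
  have h := A.isHilbertSum_eigenspace.OrthogonalFamily.hasSum_linearIsometry w
  have := A.proj_of_hasSum (fun μ => (w μ).2) h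
  simp only [this]
  exact h

/-- The square root `A^{1/2}`, given by the spectral resolution of `A`: its domain consists of the
`x` for which `∑_μ √μ P_μ x` converges in `H`, and `A^{1/2} x` is the sum of this series; `P_μ` is
the orthogonal projection onto the eigenspace for `μ`. -/
def sqrt : H →ₗ.[ℝ] H where
  domain :=
    { carrier := {x | Summable fun μ : ℝ => √μ • A.proj μ x}
      zero_mem' := by simp [summable_zero]
      add_mem' := by
        intro x y hx hy
        simpa only [Set.mem_ofPred_eq, map_add, smul_add] using Summable.add hx hy
      smul_mem' := by
        intro c x hx
        simpa only [Set.mem_ofPred_eq, map_smul, smul_comm _ c] using Summable.const_smul c hx }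
  toFun :=
    { toFun := fun x => ∑' μ : ℝ, √μ • A.proj μ (x : H)
      map_add' := by
        intro x y
        simpa only [Submodule.coe_add, map_add, smul_add] using Summable.tsum_add x.2 y.2
      map_smul' := by
        intro c x
        simpa only [Submodule.coe_smul, map_smul, smul_comm _ c, RingHom.id_apply] using
          Summable.tsum_const_smul c x.2 }

theorem hasSum_sqrt (x : A.sqrt.domain) :
    HasSum (fun μ : ℝ => √μ • A.proj μ (x : H)) (A.sqrt x) := Summable.hasSum x.2

theorem proj_sqrt (x : A.sqrt.domain) (μ : ℝ) : A.proj μ (A.sqrt x) = √μ • A.proj μ (x : H) :=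
  A.proj_of_hasSum (w := fun μ => √μ • A.proj μ (x : H))
    (fun μ => Submodule.smul_mem _ _ (A.proj_mem μ _)) (A.hasSum_sqrt x) μ

theorem norm_proj_le (x : H) (μ : ℝ) : ‖A.proj μ x‖ ^ 2 ≤ ‖A.inv‖ * ‖√μ • A.proj μ x‖ ^ 2 := by
  by_cases h0 : A.proj μ x = 0
  · simp [h0]
  have hμ := A.eigenvalue_pos (A.proj_mem μ x) h0
  have h := (A.mem_eigenspace_iff μ _).1 (A.proj_mem μ x)
  have h1 : ‖A.proj μ x‖ ≤ μ * (‖A.inv‖ * ‖A.proj μ x‖) := by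
    conv_lhs => rw [← h]
    rw [norm_smul, Real.norm_of_nonneg hμ.le]
    exact mul_le_mul_of_nonneg_left (A.inv.le_opNorm _) hμ.le
  rw [norm_smul, mul_pow, Real.norm_of_nonneg (Real.sqrt_nonneg _), Real.sq_sqrt hμ.le]
  nlinarith [norm_nonneg (A.proj μ x)]

theorem norm_sum_proj (x : H) (s : Finset ℝ) (c : ℝ → ℝ) :
    ‖∑ μ ∈ s, c μ • A.proj μ x‖ ^ 2 = ∑ μ ∈ s, ‖c μ • A.proj μ x‖ ^ 2 :=
  A.orthogonalFamily_eigenspace.norm_sum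
    (fun μ => (⟨c μ • A.proj μ x, Submodule.smul_mem _ _ (A.proj_mem μ x)⟩ : A.eigenspace μ)) s

theorem norm_le_sqrt (x : A.sqrt.domain) : ‖(x : H)‖ ^ 2 ≤ ‖A.inv‖ * ‖A.sqrt x‖ ^ 2 := by
  have h1 := ((A.hasSum_proj (x : H)).norm.pow 2 :
    Tendsto (fun s : Finset ℝ => ‖∑ μ ∈ s, A.proj μ (x : H)‖ ^ 2) atTop _)
  have h2 := (((A.hasSum_sqrt x).norm.pow 2).const_mul ‖A.inv‖ :
    Tendsto (fun s : Finset ℝ => ‖A.inv‖ * ‖∑ μ ∈ s, √μ • A.proj μ (x : H)‖ ^ 2) atTop _)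
  refine le_of_tendsto_of_tendsto' h1 h2 fun s => ?_
  have h3 := A.norm_sum_proj (x : H) s (fun _ => 1)
  simp only [one_smul] at h3
  rw [h3, A.norm_sum_proj, Finset.mul_sum]
  exact Finset.sum_le_sum fun μ _ => A.norm_proj_le _ μ

theorem sqrt_injective (x : A.sqrt.domain) (h : A.sqrt x = 0) : x = 0 := by
  have h1 := A.norm_le_sqrt x
  rw [h, norm_zero] at h1
  have h2 : ‖(x : H)‖ = 0 := by nlinarith [norm_nonneg (x : H)]
  exact Subtype.ext (norm_eq_zero.1 h2)

theorem sqrt_surjective (y : H) : ∃ x : A.sqrt.domain, A.sqrt x = y := by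
  have hs : Summable fun μ : ℝ => (√μ)⁻¹ • A.proj μ y := by
    have hy : Summable fun μ => ‖A.proj μ y‖ ^ 2 :=
      (A.orthogonalFamily_eigenspace.summable_iff_norm_sq_summable
        (fun μ => (⟨A.proj μ y, A.proj_mem μ y⟩ : A.eigenspace μ))).1 (A.hasSum_proj y).summable
    refine (A.orthogonalFamily_eigenspace.summable_iff_norm_sq_summable
      (fun μ => (⟨(√μ)⁻¹ • A.proj μ y, Submodule.smul_mem _ _ (A.proj_mem μ y)⟩ :
        A.eigenspace μ))).2 ?_
    refine Summable.of_nonneg_of_le (fun _ => by positivity) (fun μ => ?_) (hy.mul_left ‖A.inv‖)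
    change ‖(√μ)⁻¹ • A.proj μ y‖ ^ 2 ≤ _
    by_cases h0 : A.proj μ y = 0
    · simp [h0]
    have hμ := A.eigenvalue_pos (A.proj_mem μ y) h0
    have hμ' := Real.sqrt_pos.2 hμ
    have h := A.norm_proj_le y μ
    rw [norm_smul, mul_pow, Real.norm_of_nonneg (Real.sqrt_nonneg _)] at h
    rw [norm_smul, mul_pow, norm_inv, Real.norm_of_nonneg (Real.sqrt_nonneg _), inv_pow,
      inv_mul_le_iff₀ (by positivity)]
    linarith
  have hp := A.proj_of_hasSum (fun μ => Submodule.smul_mem _ _ (A.proj_mem μ y)) hs.hasSum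
  have he : (fun μ : ℝ => √μ • A.proj μ (∑' μ : ℝ, (√μ)⁻¹ • A.proj μ y)) =
      fun μ => A.proj μ y := by
    funext μ
    rw [hp]
    by_cases h0 : A.proj μ y = 0
    · simp [h0]
    have hμ' := Real.sqrt_pos.2 (A.eigenvalue_pos (A.proj_mem μ y) h0)
    rw [smul_smul, mul_inv_cancel₀ hμ'.ne', one_smul]
  have hm : (∑' μ : ℝ, (√μ)⁻¹ • A.proj μ y) ∈ A.sqrt.domain := by
    change Summable _
    rw [he]
    exact (A.hasSum_proj y).summable
  refine ⟨⟨_, hm⟩, ?_⟩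
  have := A.hasSum_sqrt ⟨_, hm⟩
  simp only [he] at this
  exact this.unique (A.hasSum_proj y)

theorem proj_op (x : A.op.domain) (μ : ℝ) : A.proj μ (A.op x) = μ • A.proj μ (x : H) := by
  have hP (y : H) (z : H) : ⟪A.proj μ y, z⟫_ℝ = ⟪y, A.proj μ z⟫_ℝ :=
    Submodule.inner_starProjection_left_eq_right _ _ _
  refine ext_inner_right ℝ fun z => ?_
  rw [hP, real_inner_smul_left, hP]
  obtain ⟨h, e⟩ := A.proj_mem μ z
  have := A.op_symm x ⟨_, h⟩
  rw [e, real_inner_smul_right] at this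
  exact this

/-- `𝒟(A) ⊆ 𝒟(A^{1/2})`. -/
theorem op_mem_sqrt_domain (x : A.op.domain) : (x : H) ∈ A.sqrt.domain := by
  change Summable _
  refine (A.orthogonalFamily_eigenspace.summable_iff_norm_sq_summable
      (fun μ => (⟨√μ • A.proj μ (x : H),
        Submodule.smul_mem _ _ (A.proj_mem μ x)⟩ :
        A.eigenspace μ))).2 ?_
  have hy : Summable fun μ => ‖A.proj μ (A.op x)‖ ^ 2 :=
      (A.orthogonalFamily_eigenspace.summable_iff_norm_sq_summable
        (fun μ => (⟨A.proj μ (A.op x), A.proj_mem μ _⟩ : A.eigenspace μ))).1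
          (A.hasSum_proj _).summable
  have hx : Summable fun μ => ‖A.proj μ (x : H)‖ ^ 2 :=
      (A.orthogonalFamily_eigenspace.summable_iff_norm_sq_summable
        (fun μ => (⟨A.proj μ x, A.proj_mem μ _⟩ : A.eigenspace μ))).1
          (A.hasSum_proj _).summable
  refine Summable.of_nonneg_of_le (fun _ => by positivity) (fun μ => ?_) (hx.add hy)
  change ‖√μ • A.proj μ (x : H)‖ ^ 2 ≤ _
  rw [A.proj_op, norm_smul, norm_smul, mul_pow, mul_pow,
    Real.norm_of_nonneg (Real.sqrt_nonneg _), Real.norm_eq_abs, sq_abs]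
  rcases le_or_gt μ 0 with h | h
  · rw [Real.sqrt_eq_zero_of_nonpos h, zero_pow two_ne_zero, zero_mul]; positivity
  · rw [Real.sq_sqrt h.le]; nlinarith [mul_nonneg (sq_nonneg (μ - 1)) (sq_nonneg ‖A.proj μ (x : H)‖),
      mul_nonneg h.le (sq_nonneg ‖A.proj μ (x : H)‖)]

/-- `A^{1/2} A^{1/2} x = A x` for `x ∈ 𝒟(A)`. -/
theorem sqrt_sqrt (x : A.op.domain) :
    ∃ h : A.sqrt ⟨x, A.op_mem_sqrt_domain x⟩ ∈ A.sqrt.domain, A.sqrt ⟨_, h⟩ = A.op x := by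
  have e : (fun μ : ℝ => √μ • A.proj μ (A.sqrt ⟨x, A.op_mem_sqrt_domain x⟩)) = fun μ => A.proj μ (A.op x) := by
    funext μ
    rw [A.proj_sqrt, A.proj_op, smul_smul]
    by_cases h : A.proj μ (x : H) = 0
    · simp [h]
    rw [Real.mul_self_sqrt (A.eigenvalue_pos (A.proj_mem μ _) h).le]
  have h : A.sqrt ⟨x, A.op_mem_sqrt_domain x⟩ ∈ A.sqrt.domain := by
    change Summable _
    rw [e]; exact (A.hasSum_proj _).summable
  refine ⟨h, ?_⟩
  have := A.hasSum_sqrt ⟨_, h⟩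
  simp only [e] at this
  exact this.unique (A.hasSum_proj _)

/-- The space `V = 𝒟(A^{1/2})` (which is complete for the norm defined below). -/
def V : Type _ := A.sqrt.domain

section Instances

/-- The vector space structure of `V`. -/
@[reducible] def addCommGroupV : AddCommGroup A.V := inferInstanceAs (AddCommGroup A.sqrt.domain)

attribute [local instance] addCommGroupV

/-- The vector space structure of `V`. -/
@[reducible] def moduleV : Module ℝ A.V := inferInstanceAs (Module ℝ A.sqrt.domain)

attribute [local instance] moduleV

/-- `A^{1/2}` on `V`, used to define the norm. -/
def sqrtAux : A.V →ₗ[ℝ] H := A.sqrt.toFun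

/-- The norm `‖φ‖_V = ‖A^{1/2} φ‖_H`. -/
instance : NormedAddCommGroup A.V :=
  NormedAddCommGroup.induced A.V H A.sqrtAux
    ((injective_iff_map_eq_zero A.sqrtAux).2 A.sqrt_injective)

/-- The inner product `⟨φ, ψ⟩_V = ⟨A^{1/2} φ, A^{1/2} ψ⟩_H`. -/
instance : InnerProductSpace ℝ A.V where
  toNormedSpace := NormedSpace.induced ℝ A.V H A.sqrtAux
  inner φ ψ := ⟪A.sqrtAux φ, A.sqrtAux ψ⟫_ℝ
  norm_sq_eq_re_inner φ := (real_inner_self_eq_norm_sq (A.sqrtAux φ)).symm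
  conj_inner_symm _ _ := real_inner_comm _ _
  add_left _ _ χ := (congrArg (⟪·, A.sqrtAux χ⟫_ℝ) (A.sqrtAux.map_add _ _)).trans
    (inner_add_left _ _ _)
  smul_left φ ψ r := (congrArg (⟪·, A.sqrtAux ψ⟫_ℝ) (A.sqrtAux.map_smul r φ)).trans
    (inner_smul_left _ _ _)

end Instances

/-- `A^{1/2}` as a linear map on `V`. -/
def sqrtV : A.V →ₗ[ℝ] H := A.sqrt.toFun

/-- The inclusion `V ⊆ H`. -/
def inclV : A.V →ₗ[ℝ] H := A.sqrt.domain.subtype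

theorem inner_V (φ ψ : A.V) : ⟪φ, ψ⟫_ℝ = ⟪A.sqrtV φ, A.sqrtV ψ⟫_ℝ := rfl

theorem norm_V (φ : A.V) : ‖φ‖ = ‖A.sqrtV φ‖ := rfl

/-- `A^{1/2} : V → H` is an isometric isomorphism. -/
def sqrtEquiv : A.V ≃ₗᵢ[ℝ] H :=
  LinearIsometryEquiv.ofSurjective ⟨A.sqrtV, fun φ => (A.norm_V φ).symm⟩ A.sqrt_surjective

/-- `𝒟(A^{1/2})` is complete for the norm of `V`, so that it coincides with its completion. -/
instance : CompleteSpace A.V := 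
  (completeSpace_congr (e := A.sqrtEquiv.toEquiv) A.sqrtEquiv.isometry.isUniformEmbedding).2 ‹_›

/-- The continuous inclusion `V ↪ H`. -/
def inclVL : A.V →L[ℝ] H :=
  A.inclV.mkContinuous √‖A.inv‖ fun φ => by
    have h : ‖A.inclV φ‖ ^ 2 ≤ ‖A.inv‖ * ‖A.sqrtV φ‖ ^ 2 := A.norm_le_sqrt φ
    rw [A.norm_V]
    refine abs_le_of_sq_le_sq' ?_ (by positivity) |>.2
    rwa [mul_pow, Real.sq_sqrt (norm_nonneg _)]

/-- The dual space `V*` with the dual norm, paired with `V` by evaluation. -/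
abbrev VDual : Type _ := StrongDual ℝ A.V

/-- The embedding `V ↪ H ≅ H* ↪ V*` of the Gelfand triple: `φ ↦ (ψ ↦ ⟨φ, ψ⟩_H)`. -/
def embV : A.V →L[ℝ] A.VDual :=
  ((innerSL ℝ).bilinearComp A.inclVL A.inclVL : A.V →L[ℝ] A.V →L[ℝ] ℝ)

/-- The bounded operator `A* : V → V*` with `⟨ψ, A* φ⟩ = ⟨ψ, φ⟩_V`. -/
def adj : A.V →L[ℝ] A.VDual := (innerSL ℝ : A.V →L[ℝ] A.V →L[ℝ] ℝ)

theorem embV_apply (φ ψ : A.V) : A.embV φ ψ = ⟪A.inclV φ, A.inclV ψ⟫_ℝ := rfl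

theorem adj_apply (φ ψ : A.V) : A.adj φ ψ = ⟪ψ, φ⟫_ℝ := real_inner_comm _ _

end EllipticOperator

end Operator

section Bochner

variable {E : Type*} [NormedAddCommGroup E] [NormedSpace ℝ E]

/-- Lebesgue measure on the time interval `[0, T]`. -/
abbrev timeMeasure (T : ℝ) : Measure ℝ := volume.restrict (Icc 0 T)

/-- The Bochner space `L²([0, T]; E)`. -/
abbrev L2 (T : ℝ) (E : Type*) [NormedAddCommGroup E] : Type _ := Lp E 2 (timeMeasure T)

/-- `g` is the distributional derivative of the `E`-valued function `f` on `(0, T)`. -/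
def IsTimeDeriv (T : ℝ) (f g : ℝ → E) : Prop :=
  ∀ w : ℝ → ℝ, ContDiff ℝ ∞ w → HasCompactSupport w → tsupport w ⊆ Ioo 0 T →
    ∫ t, w t • g t ∂timeMeasure T = -∫ t, deriv w t • f t ∂timeMeasure T

/-- `f` has a representative that is continuous on `[0, T]` and vanishes at `T`. -/
def VanishesAtEnd (T : ℝ) (f : ℝ → E) : Prop :=
  ∃ c : ℝ → E, ContinuousOn c (Icc 0 T) ∧ f =ᵐ[timeMeasure T] c ∧ c T = 0

theorem integrable_test {T : ℝ} (f : L2 T E) {w : ℝ → ℝ} (hw : Continuous w)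
    (hc : HasCompactSupport w) : Integrable (fun t => w t • f t) (timeMeasure T) := by
  obtain ⟨C, hC⟩ := hc.exists_bound_of_continuous hw
  exact ((Lp.memLp f).integrable one_le_two).bdd_smul C hw.aestronglyMeasurable
    (Eventually.of_forall hC)

/-- The space `H¹_{0,{T}}([0, T]; E) = {f ∈ H¹([0, T]; E) : f(T) = 0}`, where an element `f` is
stored as the pair `(f, ∂ₜf)` of elements of `L²([0, T]; E)`. -/
def H1End (T : ℝ) (E : Type*) [NormedAddCommGroup E] [NormedSpace ℝ E] :
    Submodule ℝ (L2 T E × L2 T E) where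
  carrier := {p | IsTimeDeriv T p.1 p.2 ∧ VanishesAtEnd T p.1}
  zero_mem' := by
    have h := Lp.coeFn_zero E 2 (timeMeasure T)
    refine ⟨fun w _ _ _ => ?_, fun _ => 0, continuousOn_const, h, rfl⟩
    have h1 (w : ℝ → ℝ) : ∫ t, w t • (0 : L2 T E) t ∂timeMeasure T = 0 := by
      refine integral_eq_zero_of_ae ?_
      filter_upwards [h] with t ht
      rw [ht]; exact smul_zero _
    exact (h1 w).trans (by rw [Prod.fst_zero, h1, neg_zero])
  add_mem' := by
    rintro ⟨f, f'⟩ ⟨g, g'⟩ ⟨hf, c, hc, hfc, hcT⟩ ⟨hg, d, hd, hgd, hdT⟩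
    refine ⟨fun w hw hs ht => ?_, fun t => c t + d t, hc.add hd, ?_, by simp [hcT, hdT]⟩
    · have key (a b : L2 T E) (w : ℝ → ℝ) (hw : Continuous w) (hs : HasCompactSupport w) :
          ∫ t, w t • (a + b : L2 T E) t ∂timeMeasure T =
            (∫ t, w t • a t ∂timeMeasure T) + ∫ t, w t • b t ∂timeMeasure T := by
        rw [← integral_add (integrable_test a hw hs) (integrable_test b hw hs)]
        refine integral_congr_ae ?_
        filter_upwards [Lp.coeFn_add a b] with t ht
        rw [ht, Pi.add_apply, smul_add]
      have h1 := hf w hw hs ht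
      have h2 := hg w hw hs ht
      simp only at h1 h2
      simp only [Prod.mk_add_mk]
      rw [key f' g' w hw.continuous hs,
        key f g (deriv w) (hw.continuous_deriv (by simp)) hs.deriv, h1, h2]
      exact (neg_add _ _).symm
    · filter_upwards [Lp.coeFn_add f g, hfc, hgd] with t h1 h2 h3
      change (f + g : L2 T E) t = _
      rw [h1, Pi.add_apply, ← h2, ← h3]
  smul_mem' := by
    rintro r ⟨f, f'⟩ ⟨hf, c, hc, hfc, hcT⟩
    refine ⟨fun w hw hs ht => ?_, fun t => r • c t, hc.const_smul r, ?_, by simp [hcT]⟩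
    · have key (a : L2 T E) (w : ℝ → ℝ) :
          ∫ t, w t • (r • a : L2 T E) t ∂timeMeasure T =
            r • ∫ t, w t • a t ∂timeMeasure T := by
        rw [← integral_smul]
        refine integral_congr_ae ?_
        filter_upwards [Lp.coeFn_smul r a] with t ht
        rw [ht, Pi.smul_apply, smul_comm]
      have h1 := hf w hw hs ht
      simp only at h1
      simp only [Prod.smul_mk]
      rw [key f', key f, h1, smul_neg]
    · filter_upwards [Lp.coeFn_smul r f, hfc] with t h1 h2
      change (r • f : L2 T E) t = _
      rw [h1, Pi.smul_apply, ← h2]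

/-- The distributional derivative is unique. -/
theorem timeDeriv_unique [CompleteSpace E] {T : ℝ} {f : ℝ → E} {g g' : L2 T E}
    (h : IsTimeDeriv T f g) (h' : IsTimeDeriv T f g') : g = g' := by
  refine Lp.ext ?_
  have hi (a : L2 T E) : IntegrableOn a (Icc 0 T) := (Lp.memLp a).integrable one_le_two
  have hl : LocallyIntegrableOn (fun t => g t - g' t) (Ioo 0 T) :=
    (((hi g).sub (hi g')).mono_set Ioo_subset_Icc_self).locallyIntegrableOn
  have key := isOpen_Ioo.ae_eq_zero_of_integral_contDiff_smul_eq_zero hl fun w hw hs ht => by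
    have h0 : ∀ t, t ∉ Icc 0 T → w t • (g t - g' t) = 0 := fun t htT => by
      have : w t = 0 := by
        by_contra hne
        exact htT (Ioo_subset_Icc_self (ht (subset_tsupport _ hne)))
      rw [this, zero_smul]
    rw [← setIntegral_eq_integral_of_forall_compl_eq_zero h0]
    change ∫ t, _ ∂timeMeasure T = 0
    simp only [smul_sub]
    rw [integral_sub (integrable_test g hw.continuous hs) (integrable_test g' hw.continuous hs),
      h w hw hs ht, h' w hw hs ht, sub_self]
  change ∀ᵐ t ∂volume.restrict (Icc 0 T), g t = g' t
  rw [← restrict_Ioo_eq_restrict_Icc]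
  filter_upwards [ae_restrict_of_ae key, ae_restrict_mem measurableSet_Ioo] with t h1 h2
  exact sub_eq_zero.1 (h1 h2)

/-- The pairing `(g, f) ↦ ∫₀ᵀ ⟨f(t), g(t)⟩ dt` of `L²([0, T]; E')` and `L²([0, T]; E)`. -/
def pairing (T : ℝ) (E : Type*) [NormedAddCommGroup E] [NormedSpace ℝ E] :
    L2 T (StrongDual ℝ E) →L[ℝ] L2 T E →L[ℝ] ℝ :=
  (ContinuousLinearMap.id ℝ (StrongDual ℝ E)).lpPairing (timeMeasure T) 2 2

theorem pairing_apply {T : ℝ} (g : L2 T (StrongDual ℝ E)) (f : L2 T E) :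
    pairing T E g f = ∫ t, g t (f t) ∂timeMeasure T :=
  (ContinuousLinearMap.id ℝ (StrongDual ℝ E)).lpPairing_eq_integral g f

theorem pairing_bound (T : ℝ) (E : Type*) [NormedAddCommGroup E] [NormedSpace ℝ E] :
    ∃ C : ℝ, 0 ≤ C ∧ ∀ (g : L2 T (StrongDual ℝ E)) (f : L2 T E),
      ‖pairing T E g f‖ ≤ C * ‖g‖ * ‖f‖ :=
  ⟨‖pairing T E‖, (pairing T E).opNorm_nonneg, fun g f => (pairing T E).le_opNorm₂ g f⟩

end Bochner

namespace EllipticOperator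

variable {H : Type*} [NormedAddCommGroup H] [InnerProductSpace ℝ H] [CompleteSpace H]
  (A : EllipticOperator H) (T : ℝ)

/-- The trial space `𝒳 = L²([0, T]; V)`. -/
def X : Type _ := L2 T A.V

instance : NormedAddCommGroup (A.X T) := inferInstanceAs (NormedAddCommGroup (L2 T A.V))

instance : NormedSpace ℝ (A.X T) := inferInstanceAs (NormedSpace ℝ (L2 T A.V))

/-- The embedding `L²([0, T]; V) → L²([0, T]; V*)` induced by `V ↪ V*`. -/
def embL2 : L2 T A.V →L[ℝ] L2 T A.VDual := A.embV.compLpL 2 (timeMeasure T)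

/-- The pairs `(v, ∂ₜv)` with `v ∈ L²([0, T]; V) ∩ H¹_{0,{T}}([0, T]; V*)`. -/
def graphY : Submodule ℝ (WithLp 2 (L2 T A.V × L2 T A.VDual)) where
  carrier := {p | (A.embL2 T p.fst, p.snd) ∈ H1End T A.VDual}
  zero_mem' := by
    have := (H1End T A.VDual).zero_mem
    rw [← Prod.mk_zero_zero] at this
    nth_rw 1 [← map_zero (A.embL2 T)] at this
    exact this
  add_mem' := by
    intro p q hp hq
    have := (H1End T A.VDual).add_mem hp hq
    simpa using this
  smul_mem' := by
    intro r p hp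
    have := (H1End T A.VDual).smul_mem r hp
    simpa using this

/-- The test space `𝒴 = L²([0, T]; V) ∩ H¹_{0,{T}}([0, T]; V*)`. An element `v` is stored as the pair
`(v, ∂ₜv)`; the norm is `‖v‖² = ‖v‖²_{L²([0, T]; V)} + ‖∂ₜv‖²_{L²([0, T]; V*)}`. -/
def Y : Type _ := A.graphY T

instance : NormedAddCommGroup (A.Y T) := inferInstanceAs (NormedAddCommGroup (A.graphY T))

instance : NormedSpace ℝ (A.Y T) := inferInstanceAs (NormedSpace ℝ (A.graphY T))

variable {A T}

/-- The function in `L²([0, T]; V)` underlying an element of `𝒳`. -/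
def X.val (u : A.X T) : L2 T A.V := u

/-- The function in `L²([0, T]; V)` underlying an element of `𝒴`. -/
def Y.val (v : A.Y T) : L2 T A.V := (Subtype.val v : WithLp 2 (L2 T A.V × L2 T A.VDual)).fst

/-- The derivative `∂ₜv ∈ L²([0, T]; V*)` of an element `v` of `𝒴`. -/
def Y.dt (v : A.Y T) : L2 T A.VDual := (Subtype.val v : WithLp 2 (L2 T A.V × L2 T A.VDual)).snd

theorem Y.norm_sq (v : A.Y T) : ‖v‖ ^ 2 = ‖Y.val v‖ ^ 2 + ‖Y.dt v‖ ^ 2 :=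
  WithLp.prod_norm_sq_eq_of_L2 (Subtype.val v : WithLp 2 (L2 T A.V × L2 T A.VDual))

/-- An element of `𝒴` is determined by its underlying function. -/
theorem Y.val_injective : Function.Injective (Y.val : A.Y T → L2 T A.V) := by
  rintro ⟨p, hp⟩ ⟨q, hq⟩ h
  have h' : p.fst = q.fst := h
  refine Subtype.ext (WithLp.ofLp_injective 2 (Prod.ext h' ?_))
  have h1 := hp.1
  rw [h'] at h1
  exact timeDeriv_unique h1 hq.1

/-- The bilinear form `ℬ(u, v) = ∫₀ᵀ ⟨u(t), (-∂ₜ + A*) v(t)⟩ dt` on `𝒳 × 𝒴`. -/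
def form (u : A.X T) (v : A.Y T) : ℝ :=
  ∫ t in Icc 0 T, (-(Y.dt v t) + A.adj (Y.val v t)) (X.val u t)

theorem form_eq (u : A.X T) (v : A.Y T) : form u v =
    -pairing T A.V (Y.dt v) (X.val u) +
      pairing T A.V (A.adj.compLpL 2 (timeMeasure T) (Y.val v)) (X.val u) := by
  have e : form u v = pairing T A.V
      (-(Y.dt v) + A.adj.compLpL 2 (timeMeasure T) (Y.val v)) (X.val u) := by
    rw [pairing_apply]
    refine integral_congr_ae ?_
    filter_upwards [Lp.coeFn_add (-(Y.dt v)) (A.adj.compLpL 2 (timeMeasure T) (Y.val v)),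
      Lp.coeFn_neg (Y.dt v), A.adj.coeFn_compLpL (p := 2) (Y.val v)] with t h1 h2 h3
    rw [h1, Pi.add_apply, h2, h3]
    rfl
  rw [e, map_add, map_neg]
  rfl

theorem form_bound : ∃ C : ℝ, ∀ (u : A.X T) (v : A.Y T), ‖form u v‖ ≤ C * ‖u‖ * ‖v‖ := by
  obtain ⟨C, hC, h⟩ := pairing_bound T A.V
  set D := A.adj.compLpL 2 (timeMeasure T)
  refine ⟨C * (1 + ‖D‖), fun u v => ?_⟩
  have hsq := Y.norm_sq v
  have h1 : ‖Y.dt v‖ ≤ ‖v‖ :=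
    (sq_le_sq₀ (norm_nonneg _) (norm_nonneg _)).1 (by nlinarith [sq_nonneg ‖Y.val v‖])
  have h2 : ‖Y.val v‖ ≤ ‖v‖ :=
    (sq_le_sq₀ (norm_nonneg _) (norm_nonneg _)).1 (by nlinarith [sq_nonneg ‖Y.dt v‖])
  have h3 : ‖X.val u‖ = ‖u‖ := rfl
  rw [form_eq]
  calc _ ≤ ‖pairing T A.V (Y.dt v) (X.val u)‖ + ‖pairing T A.V (D (Y.val v)) (X.val u)‖ := by
        refine (norm_add_le _ _).trans ?_
        rw [norm_neg]
    _ ≤ C * ‖v‖ * ‖u‖ + C * (‖D‖ * ‖v‖) * ‖u‖ := by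
        refine add_le_add ((h _ _).trans ?_) ((h _ _).trans ?_)
        · rw [h3]; gcongr
        · rw [h3]; gcongr; exact (D.le_opNorm _).trans (by gcongr)
    _ = _ := by ring

variable (A T)

/-- The bounded operator `𝔹 : 𝒳 → 𝒴'` with `𝔹 u = ℬ(u, ·)`. -/
def opB : A.X T →L[ℝ] StrongDual ℝ (A.Y T) :=
  LinearMap.mkContinuousOfExistsBound₂
    (LinearMap.mk₂ ℝ (form : A.X T → A.Y T → ℝ)
      (fun u u' v => by
        have h1 : X.val (u + u') = X.val u + X.val u' := rfl
        simp only [form_eq, h1, map_add]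
        ring)
      (fun c u v => by
        have h1 : X.val (c • u) = c • X.val u := rfl
        simp only [form_eq, h1, map_smul, smul_eq_mul]
        ring)
      (fun u v v' => by
        have h1 : Y.dt (v + v') = Y.dt v + Y.dt v' := rfl
        have h2 : Y.val (v + v') = Y.val v + Y.val v' := rfl
        simp only [form_eq, h1, h2, map_add, _root_.add_apply]
        ring)
      (fun c u v => by
        have h1 : Y.dt (c • v) = c • Y.dt v := rfl
        have h2 : Y.val (c • v) = c • Y.val v := rfl
        simp only [form_eq, h1, h2, map_smul, _root_.smul_apply, smul_eq_mul]
        ring))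
    form_bound

theorem opB_apply (u : A.X T) (v : A.Y T) : A.opB T u v = form u v := rfl

end EllipticOperator

section Tensor

/-- The projective tensor product `E^(π)` of `E` with itself: the completion of the algebraic tensor
product `E ⊗ E` (Mathlib's tensor power indexed by `Fin 2`) for the projective norm. -/
abbrev ProjSquare (E : Type*) [NormedAddCommGroup E] [NormedSpace ℝ E] : Type _ :=
  UniformSpace.Completion (⨂[ℝ] _ : Fin 2, E)

/-- The elementary tensor `x ⊗ y` in `E^(π)`. -/
def elem {E : Type*} [NormedAddCommGroup E] [NormedSpace ℝ E] (x y : E) : ProjSquare E :=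
  ((PiTensorProduct.tprod ℝ ![x, y] : ⨂[ℝ] _ : Fin 2, E) : ProjSquare E)

end Tensor

end Parabolic

end

/-! A lower bound for `𝔹` alone does not pass to `𝔹 ⊗ 𝔹`, because the projective norm is not
inherited by subspaces. A left inverse does pass: if `L` satisfies `L 𝔹 = id` and `‖L‖ ≤ 1`, then
`(L ⊗ L)(𝔹 ⊗ 𝔹) = id` and `‖L ⊗ L‖ ≤ ‖L‖² ≤ 1`, so `‖u‖ ≤ ‖(𝔹 ⊗ 𝔹) u‖`
(`norm_le_projSquareMap_apply`). Everything reduces to finding `L : 𝒴' → 𝒳`.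

The Riesz isometry `A* : V → V*` turns the form into `(𝔹 u)(v) = ⟪u, b v⟫` in `L²(V)`, where `b v =
v - (A*)⁻¹ ∂ₜv` (`form_eq_inner`). Hence `L f` should be the `u` with `⟪u, b v⟫ = f v`. Two facts
are needed on a class of smooth `v`. The energy estimate `‖v‖ ≤ ‖b v‖` (`norm_le_norm_backward`)
gives existence and `‖L‖ ≤ 1`; density of the values `b v` in `L²(V)` (`denseRange_backward`) gives
uniqueness, hence `L 𝔹 u = u`.

Density needs no general theory of parabolic equations. For an eigenvector `x` of `A`, the equation
`b v = φ x` is a scalar linear ODE with an explicit solution, and the eigenvectors are total in `V`.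
-/

noncomputable section

namespace Parabolic

/-! ### Functoriality of the projective tensor square -/

section ProjectiveSquare

variable {E F : Type*} [NormedAddCommGroup E] [NormedSpace ℝ E] [NormedAddCommGroup F]
  [NormedSpace ℝ F]

/-- Continuous linear maps on `E^(π)` that agree on elementary tensors are equal. -/
theorem projSquare_hom_ext {G : Type*} [NormedAddCommGroup G] [NormedSpace ℝ G]
    {S S' : ProjSquare E →L[ℝ] G} (h : ∀ x y, S (elem x y) = S' (elem x y)) : S = S' := by
  refine ContinuousLinearMap.ext fun z => ?_
  induction z using UniformSpace.Completion.induction_on with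
  | hp => exact isClosed_eq S.continuous S'.continuous
  | ih a =>
    have key : S.toLinearMap ∘ₗ
        (UniformSpace.Completion.toComplL : (⨂[ℝ] _ : Fin 2, E) →L[ℝ] ProjSquare E).toLinearMap =
        S'.toLinearMap ∘ₗ
        (UniformSpace.Completion.toComplL : (⨂[ℝ] _ : Fin 2, E) →L[ℝ] ProjSquare E).toLinearMap := by
      refine PiTensorProduct.ext (MultilinearMap.ext fun m => ?_)
      have := h (m 0) (m 1)
      -- A family indexed by `Fin 2` is the pair of its two values.
      rw [elem, ← List.ofFn_inj.1 (by simp : List.ofFn m = List.ofFn ![m 0, m 1])] at this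
      exact this
    exact LinearMap.congr_fun key a

/-- The operator `S ⊗ S` on the projective square. -/
def projSquareMap (S : E →L[ℝ] F) : ProjSquare E →L[ℝ] ProjSquare F :=
  (PiTensorProduct.mapL fun _ : Fin 2 => S).completion

theorem projSquareMap_elem (S : E →L[ℝ] F) (x y : E) :
    projSquareMap S (elem x y) = elem (S x) (S y) := by
  have h : PiTensorProduct.mapL (fun _ : Fin 2 => S) (PiTensorProduct.tprod ℝ ![x, y]) =
      PiTensorProduct.tprod ℝ ![S x, S y] := by
    rw [PiTensorProduct.mapL_apply, PiTensorProduct.map_tprod]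
    congr 1
    funext i
    fin_cases i <;> rfl
  rw [elem, elem, ← h]
  exact ContinuousLinearMap.completion_apply_coe _ _

/-- On the algebraic tensor product the norm of `S ⊗ S` is at most `‖S‖²`; the inequality extends to
the completion by density. -/
theorem norm_projSquareMap_apply_le {S : E →L[ℝ] F} (hS : ‖S‖ ≤ 1) (z : ProjSquare E) :
    ‖projSquareMap S z‖ ≤ ‖z‖ := by
  induction z using UniformSpace.Completion.induction_on with
  | hp => exact isClosed_le (projSquareMap S).continuous.norm continuous_norm
  | ih a =>
    have e : projSquareMap S (a : ProjSquare E) =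
        ((PiTensorProduct.mapL (fun _ : Fin 2 => S) a : ⨂[ℝ] _ : Fin 2, F) : ProjSquare F) :=
      ContinuousLinearMap.completion_apply_coe _ _
    rw [e, UniformSpace.Completion.norm_coe, UniformSpace.Completion.norm_coe]
    refine (ContinuousLinearMap.le_of_opNorm_le _ (PiTensorProduct.opNorm_mapL _) a).trans ?_
    rw [Finset.prod_const]
    exact mul_le_of_le_one_left (norm_nonneg _) (pow_le_one₀ (norm_nonneg _) hS)

/-- If `S` has a left inverse of norm at most one, then `S ⊗ S` is bounded below by one. -/
theorem norm_le_projSquareMap_apply {S : E →L[ℝ] F} {L : F →L[ℝ] E} (hL : ‖L‖ ≤ 1)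
    (hLS : ∀ x, L (S x) = x) (z : ProjSquare E) : ‖z‖ ≤ ‖projSquareMap S z‖ := by
  have h : projSquareMap L ∘L projSquareMap S = ContinuousLinearMap.id ℝ (ProjSquare E) :=
    projSquare_hom_ext fun x y => by
      rw [ContinuousLinearMap.comp_apply, projSquareMap_elem, projSquareMap_elem, hLS, hLS]
      rfl
  calc ‖z‖ = ‖projSquareMap L (projSquareMap S z)‖ :=
        congrArg norm (DFunLike.congr_fun h z).symm
    _ ≤ _ := norm_projSquareMap_apply_le hL _

end ProjectiveSquare

/-! ### Classical derivatives as distributional derivatives -/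

section ClassicalDerivative

variable {E : Type*} [NormedAddCommGroup E]
/-- A classical derivative is a distributional derivative. -/
theorem isTimeDeriv_of_hasDerivAt [NormedSpace ℝ E] [CompleteSpace E] {T : ℝ} (hT : 0 < T) {c c' : ℝ → E}
    (hc : ∀ t, HasDerivAt c (c' t) t) (hc' : Continuous c') : IsTimeDeriv T c c' := by
  intro w hw hs ht
  have hcc : Continuous c := continuous_iff_continuousAt.2 fun t => (hc t).continuousAt
  have hw' : Continuous (deriv w) := hw.continuous_deriv (by simp)
  have hd : ∀ t, HasDerivAt (fun t => w t • c t) (w t • c' t + deriv w t • c t) t := fun t =>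
    ((hw.differentiable (by simp)) t).hasDerivAt.smul (hc t)
  have h1 : Continuous fun t => w t • c' t := hw.continuous.smul hc'
  have h2 : Continuous fun t => deriv w t • c t := hw'.smul hcc
  have h := intervalIntegral.integral_eq_sub_of_hasDerivAt (fun t _ => hd t)
    ((h1.add h2).intervalIntegrable 0 T)
  -- The support of `w` lies in the open interval, so integration by parts leaves no boundary terms.
  have w0 : w 0 = 0 := by
    by_contra hne
    exact lt_irrefl _ (ht (subset_tsupport _ hne)).1
  have wT : w T = 0 := by
    by_contra hne
    exact lt_irrefl _ (ht (subset_tsupport _ hne)).2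
  rw [w0, wT, zero_smul, zero_smul, sub_zero, intervalIntegral.integral_add
    (h1.intervalIntegrable 0 T) (h2.intervalIntegrable 0 T), intervalIntegral.integral_of_le hT.le,
    intervalIntegral.integral_of_le hT.le, ← integral_Icc_eq_integral_Ioc,
    ← integral_Icc_eq_integral_Ioc] at h
  exact eq_neg_of_add_eq_zero_left h

theorem memLp_of_continuous {T : ℝ} {c : ℝ → E} (hc : Continuous c) :
    MemLp c 2 (timeMeasure T) := by
  obtain ⟨C, hC⟩ := isCompact_Icc.exists_bound_of_continuousOn (s := Icc 0 T) hc.continuousOn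
  exact MemLp.of_bound hc.aestronglyMeasurable C ((ae_restrict_iff' measurableSet_Icc).2
    (Eventually.of_forall hC))

end ClassicalDerivative

/-! ### The form as an inner product on `L²([0, T]; V)` -/

namespace EllipticOperator

variable {H : Type*} [NormedAddCommGroup H] [InnerProductSpace ℝ H] [CompleteSpace H]
  (A : EllipticOperator H) (T : ℝ)

/-- The isometric isomorphism `A* : V → V*`. -/
def adjEquiv : A.V ≃ₗᵢ[ℝ] A.VDual :=
  LinearIsometryEquiv.ofSurjective ⟨A.adj.toLinearMap, fun φ => innerSL_apply_norm ℝ φ⟩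
    fun f => ⟨(InnerProductSpace.toDual ℝ A.V).symm f, by
      refine ContinuousLinearMap.ext fun φ => ?_
      exact InnerProductSpace.toDual_symm_apply (𝕜 := ℝ) (E := A.V) (x := φ) (y := f)⟩

theorem inner_adjEquiv_symm (φ : A.V) (f : A.VDual) : ⟪φ, A.adjEquiv.symm f⟫_ℝ = f φ := by
  rw [← A.adj_apply]
  exact DFunLike.congr_fun (A.adjEquiv.apply_symm_apply f) φ

/-- The inverse of `A*` on `L²([0, T]; V*)`. -/
def adjInvL2 : L2 T A.VDual →L[ℝ] L2 T A.V :=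
  (A.adjEquiv.symm.toContinuousLinearEquiv : A.VDual →L[ℝ] A.V).compLpL 2 (timeMeasure T)

theorem coeFn_adjInvL2 (f : L2 T A.VDual) :
    A.adjInvL2 T f =ᵐ[timeMeasure T] fun t => A.adjEquiv.symm (f t) :=
  ContinuousLinearMap.coeFn_compLpL _ f

theorem norm_adjInvL2 (f : L2 T A.VDual) : ‖A.adjInvL2 T f‖ = ‖f‖ := by
  rw [Lp.norm_def, Lp.norm_def]
  congr 1
  refine eLpNorm_congr_norm_ae ?_
  filter_upwards [A.coeFn_adjInvL2 T f] with t ht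
  rw [ht, LinearIsometryEquiv.norm_map]

/-- The operator `v ↦ v - (A*)⁻¹ ∂ₜv` from `𝒴` to `L²([0, T]; V)`. -/
def backward : A.Y T →ₗ[ℝ] L2 T A.V where
  toFun v := Y.val v - A.adjInvL2 T (Y.dt v)
  map_add' v w := by
    have h1 : Y.dt (v + w) = Y.dt v + Y.dt w := rfl
    have h2 : Y.val (v + w) = Y.val v + Y.val w := rfl
    rw [h1, h2, map_add, add_sub_add_comm]
  map_smul' r v := by
    have h1 : Y.dt (r • v) = r • Y.dt v := rfl
    have h2 : Y.val (r • v) = r • Y.val v := rfl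
    rw [h1, h2, map_smul, ← smul_sub, RingHom.id_apply]

variable {A T}

theorem backward_apply (v : A.Y T) : A.backward T v = Y.val v - A.adjInvL2 T (Y.dt v) := rfl

theorem inner_adjInvL2 (u : L2 T A.V) (f : L2 T A.VDual) :
    ⟪u, A.adjInvL2 T f⟫_ℝ = ∫ t, f t (u t) ∂timeMeasure T := by
  rw [L2.inner_def]
  refine integral_congr_ae ?_
  filter_upwards [A.coeFn_adjInvL2 T f] with t ht
  rw [ht, inner_adjEquiv_symm]

/-- Pointwise, `(A*)⁻¹` is the Riesz map, which turns the pairing of `V*` with `V` into the inner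
product of `V`. -/
theorem form_eq_inner (u : A.X T) (v : A.Y T) :
    form u v = ⟪X.val u, A.backward T v⟫_ℝ := by
  rw [L2.inner_def]
  refine integral_congr_ae ?_
  filter_upwards [Lp.coeFn_sub (Y.val v) (A.adjInvL2 T (Y.dt v)), A.coeFn_adjInvL2 T (Y.dt v)]
    with t h1 h2
  rw [backward_apply, h1, Pi.sub_apply, h2, inner_sub_right, inner_adjEquiv_symm,
    _root_.add_apply, _root_.neg_apply, adj_apply]
  ring

/-! ### Smooth test functions and the energy estimate -/

variable (A T)

/-- The elements of `𝒴` represented by a continuously differentiable `V`-valued function. -/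
def smoothY : Submodule ℝ (A.Y T) where
  -- The representative is differentiable on all of `ℝ`, which avoids one-sided derivatives at the
  -- endpoints.
  carrier := {v | ∃ c c' : ℝ → A.V, (∀ t, HasDerivAt c (c' t) t) ∧ Continuous c' ∧ c T = 0 ∧
    Y.val v =ᵐ[timeMeasure T] c ∧ Y.dt v =ᵐ[timeMeasure T] fun t => A.embV (c' t)}
  zero_mem' := ⟨0, 0, fun t => hasDerivAt_const t 0, continuous_const, rfl,
    Lp.coeFn_zero _ _ _, by
      filter_upwards [Lp.coeFn_zero A.VDual 2 (timeMeasure T)] with t ht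
      rw [Pi.zero_apply, map_zero]
      exact ht⟩
  add_mem' := by
    rintro v w ⟨c, c', hc, hc', hcT, h1, h2⟩ ⟨d, d', hd, hd', hdT, h3, h4⟩
    refine ⟨c + d, c' + d', fun t => (hc t).add (hd t), hc'.add hd', by simp [hcT, hdT], ?_, ?_⟩
    · exact (Lp.coeFn_add (Y.val v) (Y.val w)).trans (h1.add h3)
    · filter_upwards [Lp.coeFn_add (Y.dt v) (Y.dt w), h2, h4] with t e1 e2 e3
      rw [Pi.add_apply, map_add, ← e2, ← e3]
      exact e1
  smul_mem' := by
    rintro r v ⟨c, c', hc, hc', hcT, h1, h2⟩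
    refine ⟨r • c, r • c', fun t => (hc t).const_smul r, hc'.const_smul r, by simp [hcT], ?_, ?_⟩
    · exact (Lp.coeFn_smul r (Y.val v)).trans (h1.const_smul r)
    · filter_upwards [Lp.coeFn_smul r (Y.dt v), h2] with t e1 e2
      rw [Pi.smul_apply, map_smul, ← e2]
      exact e1

variable {A T}

/-- The energy estimate `‖v‖_𝒴 ≤ ‖(-∂ₜ + A*) v‖_{L²([0, T]; V*)}`. -/
theorem norm_le_norm_backward (hT : 0 < T) {v : A.Y T} (hv : v ∈ A.smoothY T) :
    ‖v‖ ≤ ‖A.backward T v‖ := by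
  obtain ⟨c, c', hc, hc', hcT, h1, h2⟩ := hv
  have hcc : Continuous c := continuous_iff_continuousAt.2 fun t => (hc t).continuousAt
  set i := A.inclVL
  have hi : ∀ t, HasDerivAt (fun t => i (c t)) (i (c' t)) t := fun t =>
    i.hasFDerivAt.comp_hasDerivAt t (hc t)
  have hd : ∀ t, HasDerivAt (fun t => ⟪i (c t), i (c t)⟫_ℝ)
      (⟪i (c t), i (c' t)⟫_ℝ + ⟪i (c' t), i (c t)⟫_ℝ) t := fun t => (hi t).inner ℝ (hi t)
  have hint := intervalIntegral.integral_eq_sub_of_hasDerivAt (a := 0) (b := T) (fun t _ => hd t)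
    (Continuous.intervalIntegrable (by fun_prop) 0 T)
  -- The cross term is `∫₀ᵀ ½ (d/dt) ‖c‖²_H = -½ ‖c 0‖²_H`, because `c T = 0`.
  have hle : ⟪Y.val v, A.adjInvL2 T (Y.dt v)⟫_ℝ ≤ 0 := by
    have e : ⟪Y.val v, A.adjInvL2 T (Y.dt v)⟫_ℝ =
        ∫ t in (0 : ℝ)..T, (2 : ℝ)⁻¹ * (⟪i (c t), i (c' t)⟫_ℝ + ⟪i (c' t), i (c t)⟫_ℝ) := by
      rw [inner_adjInvL2, intervalIntegral.integral_of_le hT.le, ← integral_Icc_eq_integral_Ioc]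
      refine integral_congr_ae ?_
      filter_upwards [h1, h2] with t e1 e2
      rw [e1, e2, real_inner_comm (i (c' t)) (i (c t))]
      change ⟪i (c' t), i (c t)⟫_ℝ = _
      ring
    rw [e, intervalIntegral.integral_const_mul, hint, hcT, map_zero, inner_zero_left, zero_sub]
    have := real_inner_self_nonneg (x := i (c 0))
    linarith
  refine (sq_le_sq₀ (norm_nonneg _) (norm_nonneg _)).1 ?_
  -- Expanding the square gives `‖b v‖² = ‖v‖²_𝒴` minus twice the cross term.
  rw [Y.norm_sq, backward_apply, norm_sub_sq_real, norm_adjInvL2]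
  linarith

end EllipticOperator

/-! ### Left inverses by duality -/

/-- If `j v (B u) = ⟪u, b v⟫` for maps `j` and `b` such that `b` has dense range and dominates `j`,
then `B` has a left inverse of norm at most one. -/
theorem exists_leftInverse_of_denseRange {X Z W : Type*} [NormedAddCommGroup X]
    [InnerProductSpace ℝ X] [CompleteSpace X] [NormedAddCommGroup Z] [NormedSpace ℝ Z]
    [AddCommGroup W] [Module ℝ W] (B : X →L[ℝ] Z) (b : W →ₗ[ℝ] X) (j : W →ₗ[ℝ] StrongDual ℝ Z)
    (hB : ∀ u v, j v (B u) = ⟪u, b v⟫_ℝ) (hb : ∀ v, ‖j v‖ ≤ ‖b v‖) (hd : DenseRange b) :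
    ∃ L : Z →L[ℝ] X, ‖L‖ ≤ 1 ∧ ∀ u, L (B u) = u := by
  have hj : ∀ v, ‖j v‖ ≤ 1 * ‖b v‖ := fun v => by rw [one_mul]; exact hb v
  -- The assignment `b v ↦ j v` is well defined and contractive by `hb`, so it extends from the
  -- dense range of `b` to all of `X`.
  set S : X →L[ℝ] StrongDual ℝ Z := LinearMap.extendOfNorm (F := StrongDual ℝ Z) j b
  have hS : ∀ v, S (b v) = j v := LinearMap.extendOfNorm_eq hd ⟨1, hj⟩
  have hS' : ‖S‖ ≤ 1 := LinearMap.opNorm_extendOfNorm_le hd zero_le_one hj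
  -- `R` is the transpose of `S` restricted to `Z`: `R f` is the Riesz vector of `x ↦ S x f`.
  set R : Z →ₗ[ℝ] X :=
    { toFun := fun f => (InnerProductSpace.toDual ℝ X).symm (S.flip f)
      map_add' := fun f g => by rw [map_add, map_add]
      map_smul' := fun r f => by rw [map_smul, map_smulₛₗ]; rfl }
  have hR : ∀ f, ‖R f‖ ≤ 1 * ‖f‖ := fun f => by
    refine ((InnerProductSpace.toDual ℝ X).symm.norm_map _).trans_le (S.flip.le_of_opNorm_le ?_ f)
    rwa [ContinuousLinearMap.opNorm_flip]
  refine ⟨R.mkContinuous 1 hR, R.mkContinuous_norm_le zero_le_one hR, fun u => ?_⟩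
  refine hd.eq_of_inner_left (𝕜 := ℝ) ?_
  intro v
  have h : ⟪R (B u), b v⟫_ℝ = S (b v) (B u) := InnerProductSpace.toDual_symm_apply
  exact h.trans (by rw [hS, hB])

/-! ### Totality of the eigenvectors in `V` -/

namespace EllipticOperator

variable {H : Type*} [NormedAddCommGroup H] [InnerProductSpace ℝ H] [CompleteSpace H]
  {A : EllipticOperator H} {T : ℝ}

theorem eq_of_proj_eq {x y : H} (h : ∀ μ, A.proj μ x = A.proj μ y) : x = y := by
  have hx := A.hasSum_proj x
  simp only [h] at hx
  exact hx.unique (A.hasSum_proj y)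

theorem inner_proj_left (μ : ℝ) (x y : H) : ⟪A.proj μ x, y⟫_ℝ = ⟪x, A.proj μ y⟫_ℝ :=
  Submodule.inner_starProjection_left_eq_right _ _ _

theorem proj_eq_self {μ : ℝ} {x : H} (hx : x ∈ A.eigenspace μ) : A.proj μ x = x :=
  Submodule.starProjection_eq_self_iff.2 hx

theorem sqrtV_of_mem_eigenspace {μ : ℝ} {x : A.V} (hx : A.inclV x ∈ A.eigenspace μ) :
    A.sqrtV x = √μ • A.inclV x := by
  refine A.eq_of_proj_eq fun ν => ?_
  have h1 : A.proj ν (A.sqrtV x) = √ν • A.proj ν (A.inclV x) := A.proj_sqrt x ν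
  obtain ⟨h, e⟩ := hx
  have h2 := A.proj_op ⟨_, h⟩ ν
  rw [e, map_smul] at h2
  rw [h1, map_smul]
  -- By `h2`, `ν P_ν x = μ P_ν x`, so a nonzero component forces `ν = μ`.
  by_cases h0 : A.proj ν (A.inclV x) = 0
  · rw [h0, smul_zero, smul_zero]
  · rw [smul_left_injective ℝ h0 h2]

/-- The weak form of `A x = μ x`, valid against every `z` in `V`: write `x = P_μ x`, move `P_μ` onto
`A^{1/2} z`, where it commutes with `A^{1/2}` up to the factor `√μ`, and move it back. -/
theorem inner_of_mem_eigenspace {μ : ℝ} {x : A.V} (hx : A.inclV x ∈ A.eigenspace μ) (z : A.V) :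
    ⟪z, x⟫_ℝ = μ * ⟪A.inclV z, A.inclV x⟫_ℝ := by
  by_cases h0 : A.inclV x = 0
  · rw [A.inner_V, sqrtV_of_mem_eigenspace hx, h0, smul_zero, inner_zero_right, inner_zero_right,
      mul_zero]
  have hμ := A.eigenvalue_pos hx h0
  have h1 : A.proj μ (A.sqrtV z) = √μ • A.proj μ (A.inclV z) := A.proj_sqrt z μ
  rw [A.inner_V, sqrtV_of_mem_eigenspace hx, real_inner_smul_right]
  nth_rw 1 [← proj_eq_self hx]
  rw [← inner_proj_left, h1, real_inner_smul_left, inner_proj_left, proj_eq_self hx, ← mul_assoc,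
    Real.mul_self_sqrt hμ.le]

/-- The eigenvectors of `A` span a dense subspace of `V`. -/
theorem eq_zero_of_inner_eigenvector {z : A.V}
    (h : ∀ μ : ℝ, ∀ x : A.V, A.inclV x ∈ A.eigenspace μ → ⟪z, x⟫_ℝ = 0) : z = 0 := by
  have h0 : A.inclV z = 0 := by
    refine A.eq_of_proj_eq fun μ => ?_
    rw [map_zero]
    by_contra hne
    have hm := A.proj_mem μ (A.inclV z)
    have hμ := A.eigenvalue_pos hm hne
    obtain ⟨hd, -⟩ := id hm
    -- Test `z` against its own component `P_μ z`, which lies in `𝒟(A)` and hence in `V`; this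
    -- yields `μ ‖P_μ z‖² = 0`.
    set x : A.V := (⟨_, A.op_mem_sqrt_domain ⟨_, hd⟩⟩ : A.sqrt.domain)
    have hx : A.inclV x ∈ A.eigenspace μ := hm
    have h1 := h μ x hx
    rw [inner_of_mem_eigenspace hx] at h1
    change μ * ⟪A.inclV z, A.proj μ (A.inclV z)⟫_ℝ = 0 at h1
    rw [← proj_eq_self hm, ← inner_proj_left, real_inner_self_eq_norm_sq] at h1
    have := norm_pos_iff.2 hne
    have : 0 < μ * ‖A.proj μ (A.inclV z)‖ ^ 2 := by positivity
    linarith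
  exact Subtype.ext h0

/-! ### The backward problem and density of its right-hand sides -/

theorem exists_mem_smoothY (hT : 0 < T) {c c' : ℝ → A.V} (hc : ∀ t, HasDerivAt c (c' t) t)
    (hc' : Continuous c') (hcT : c T = 0) : ∃ v ∈ A.smoothY T,
      Y.val v =ᵐ[timeMeasure T] c ∧ Y.dt v =ᵐ[timeMeasure T] fun t => A.embV (c' t) := by
  have hcc : Continuous c := continuous_iff_continuousAt.2 fun t => (hc t).continuousAt
  have m1 := memLp_of_continuous (T := T) hcc
  have m2 := memLp_of_continuous (T := T) (A.embV.continuous.comp hc')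
  have e0 := m1.coeFn_toLp
  have e2 := m2.coeFn_toLp
  have e1 : A.embL2 T (m1.toLp c) =ᵐ[timeMeasure T] fun t => A.embV (c t) := by
    filter_upwards [A.embV.coeFn_compLpL (p := 2) (m1.toLp c), e0] with t h1 h2
    rw [← h2]
    exact h1
  have hmem : WithLp.toLp 2 (m1.toLp c, m2.toLp _) ∈ A.graphY T := by
    refine ⟨fun w hw hs ht => ?_, fun t => A.embV (c t),
      (A.embV.continuous.comp hcc).continuousOn, e1, by simp [hcT]⟩
    have h := isTimeDeriv_of_hasDerivAt hT
      (fun t => A.embV.hasFDerivAt.comp_hasDerivAt t (hc t)) (A.embV.continuous.comp hc') w hw hs ht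
    refine Eq.trans (integral_congr_ae ?_) (h.trans (congrArg Neg.neg (integral_congr_ae ?_)))
    · filter_upwards [e2] with t h2
      exact congrArg (w t • ·) h2
    · filter_upwards [e1] with t h1
      exact congrArg (deriv w t • ·) h1.symm
  exact ⟨(⟨_, hmem⟩ : A.graphY T), ⟨c, c', hc, hc', hcT, e0, e2⟩, e0, e2⟩

/-- The backward problem `(-∂ₜ + A*) v = A* (φ x)` with an eigenvector `x` and a continuous scalar
function `φ` has a classical solution. -/
theorem exists_backward_eq (hT : 0 < T) {φ : ℝ → ℝ} (hφ : Continuous φ) {μ : ℝ} {x : A.V}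
    (hx : A.inclV x ∈ A.eigenspace μ) :
    ∃ v ∈ A.smoothY T, A.backward T v =ᵐ[timeMeasure T] fun t => φ t • x := by
  -- Variation of constants for `g' = μ g - μ φ` with `g T = 0`; the candidate is `v = g x`.
  set g : ℝ → ℝ := fun t => Real.exp (μ * t) * (-μ * ∫ s in T..t, Real.exp (-(μ * s)) * φ s)
  have hg : ∀ t, HasDerivAt g (μ * g t - μ * φ t) t := fun t => by
    have h1 : HasDerivAt (fun t => Real.exp (μ * t)) (Real.exp (μ * t) * (μ * 1)) t :=
      ((hasDerivAt_id t).const_mul μ).exp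
    have hcont : Continuous fun s => Real.exp (-(μ * s)) * φ s := by fun_prop
    have h2 := (intervalIntegral.integral_hasDerivAt_right (hcont.intervalIntegrable T t)
      (hcont.stronglyMeasurableAtFilter _ _) hcont.continuousAt).const_mul (-μ)
    refine (h1.mul h2).congr_deriv ?_
    have h3 : Real.exp (μ * t) * Real.exp (-(μ * t)) = 1 := by
      rw [← Real.exp_add, add_neg_cancel, Real.exp_zero]
    linear_combination (-μ * φ t) * h3
  have hgc : Continuous g := continuous_iff_continuousAt.2 fun t => (hg t).continuousAt
  obtain ⟨v, hv, e1, e2⟩ := exists_mem_smoothY hT (fun t => (hg t).smul_const x) (by fun_prop)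
    (by simp [g])
  refine ⟨v, hv, ?_⟩
  filter_upwards [Lp.coeFn_sub (Y.val v) (A.adjInvL2 T (Y.dt v)), A.coeFn_adjInvL2 T (Y.dt v),
    e1, e2] with t h1 h2 h3 h4
  rw [backward_apply, h1, Pi.sub_apply, h2, h3, h4]
  -- Against `z`, both sides become `μ φ t` times the `H`-inner product of `z` and `x`; nothing is
  -- divided by `μ`, so `μ = 0` needs no separate case.
  refine ext_inner_left ℝ fun z => ?_
  rw [inner_sub_right, inner_adjEquiv_symm, A.embV_apply, real_inner_comm (A.inclV z), real_inner_smul_right,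
    real_inner_smul_right, map_smul, real_inner_smul_right, inner_of_mem_eigenspace hx]
  ring

/-- The backward problem has a classical solution for a dense set of right-hand sides. -/
theorem denseRange_backward (hT : 0 < T) :
    DenseRange (A.backward T ∘ₗ (A.smoothY T).subtype) := by
  rw [DenseRange, ← LinearMap.coe_range, Submodule.dense_iff_topologicalClosure_eq_top,
    Submodule.topologicalClosure_eq_top_iff, eq_bot_iff]
  intro u hu
  have hint : Integrable u (timeMeasure T) := (Lp.memLp u).integrable one_le_two
  -- By the fundamental lemma of the calculus of variations it suffices that `∫ w u = 0` in `V` for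
  -- every test function `w`. This is checked against each eigenvector `x`, by solving `b v = w x`
  -- and using that `u` is orthogonal to `b v`.
  have key := isOpen_Ioo.ae_eq_zero_of_integral_contDiff_smul_eq_zero (E := ℝ) (f := u)
    (U := Ioo 0 T) (μ := volume)
    (IntegrableOn.mono_set (t := Icc 0 T) hint Ioo_subset_Icc_self).locallyIntegrableOn
    fun w hw hs ht => by
      have h0 : ∀ t, t ∉ Icc 0 T → w t • u t = 0 := fun t htT => by
        have : w t = 0 := by
          by_contra hne
          exact htT (Ioo_subset_Icc_self (ht (subset_tsupport _ hne)))
        rw [this, zero_smul]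
      rw [← setIntegral_eq_integral_of_forall_compl_eq_zero h0]
      refine A.eq_zero_of_inner_eigenvector fun μ x hx => ?_
      obtain ⟨v, hv, e⟩ := exists_backward_eq hT hw.continuous hx
      have h := (Submodule.mem_orthogonal' _ _).1 hu _ ⟨⟨v, hv⟩, rfl⟩
      rw [L2.inner_def] at h
      rw [real_inner_comm, ← integral_inner (integrable_test u hw.continuous hs), ← h]
      refine integral_congr_ae ?_
      filter_upwards [e] with t ht
      change _ = ⟪u t, A.backward T v t⟫_ℝ
      rw [ht, real_inner_smul_right, real_inner_smul_right, real_inner_comm]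
  refine Lp.ext (EventuallyEq.trans ?_ (Lp.coeFn_zero _ _ _).symm)
  change ∀ᵐ t ∂volume.restrict (Icc 0 T), u t = 0
  -- The endpoints form a null set.
  rw [← restrict_Ioo_eq_restrict_Icc]
  filter_upwards [ae_restrict_of_ae key, ae_restrict_mem measurableSet_Ioo] with t h1 h2
  exact h1 h2

variable (A) in
/-- The operator `𝔹` has a left inverse of norm at most one. -/
theorem exists_leftInverse_opB (hT : 0 < T) : ∃ L : StrongDual ℝ (A.Y T) →L[ℝ] A.X T,
    ‖L‖ ≤ 1 ∧ ∀ u, L (A.opB T u) = u := by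
  -- Here `𝒳` is viewed as the Hilbert space `L²([0, T]; V)`, and `j` is the canonical map into the
  -- bidual of `𝒴`, of which only contractivity is needed.
  exact exists_leftInverse_of_denseRange (X := L2 T A.V) (A.opB T)
    (A.backward T ∘ₗ (A.smoothY T).subtype)
    ((NormedSpace.inclusionInDoubleDual ℝ (A.Y T)).toLinearMap ∘ₗ (A.smoothY T).subtype)
    (fun u v => form_eq_inner u v)
    (fun v => (NormedSpace.double_dual_bound ℝ (A.Y T) v).trans (norm_le_norm_backward hT v.2))
    (denseRange_backward hT)

end EllipticOperator

end Parabolic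

end

theorem mainTheorem6 {H : Type*} [NormedAddCommGroup H] [InnerProductSpace ℝ H] [CompleteSpace H]
    [TopologicalSpace.SeparableSpace H] (A : Parabolic.EllipticOperator H) (T : ℝ) (hT : 0 < T) :
    (∃! Bπ : Parabolic.ProjSquare (A.X T) →L[ℝ] Parabolic.ProjSquare (StrongDual ℝ (A.Y T)),
      ∀ u₁ u₂ : A.X T, Bπ (Parabolic.elem u₁ u₂) = Parabolic.elem (A.opB T u₁) (A.opB T u₂)) ∧
    ∀ Bπ : Parabolic.ProjSquare (A.X T) →L[ℝ] Parabolic.ProjSquare (StrongDual ℝ (A.Y T)),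
      (∀ u₁ u₂ : A.X T, Bπ (Parabolic.elem u₁ u₂) = Parabolic.elem (A.opB T u₁) (A.opB T u₂)) →
      Function.Injective Bπ ∧ ∀ u : Parabolic.ProjSquare (A.X T), ‖u‖ ≤ ‖Bπ u‖ := by
  have h := Parabolic.projSquareMap_elem (A.opB T)
  -- Elementary tensors span a dense subspace, so any admissible operator is `𝔹 ⊗ 𝔹`; this gives
  -- uniqueness and lets the bound be proved for that operator alone.
  have huniq : ∀ S : Parabolic.ProjSquare (A.X T) →L[ℝ] Parabolic.ProjSquare (StrongDual ℝ (A.Y T)),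
      (∀ u₁ u₂ : A.X T, S (Parabolic.elem u₁ u₂) = Parabolic.elem (A.opB T u₁) (A.opB T u₂)) →
      S = Parabolic.projSquareMap (A.opB T) := fun S hS =>
    Parabolic.projSquare_hom_ext fun x y => (hS x y).trans (h x y).symm
  refine ⟨⟨Parabolic.projSquareMap (A.opB T), h, huniq⟩, fun S hS => ?_⟩
  obtain ⟨L, hL, hLB⟩ := A.exists_leftInverse_opB hT
  have hb : ∀ u, ‖u‖ ≤ ‖S u‖ := fun u => by
    rw [huniq S hS]
    exact Parabolic.norm_le_projSquareMap_apply hL hLB u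
  refine ⟨(injective_iff_map_eq_zero S).2 fun u hu => ?_, hb⟩
  have := hb u
  rwa [hu, norm_zero, norm_le_zero_iff] at this
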